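/- Let $\mathcal A$ be a commutative complex Banach algebra (not necessarily with unit) that is semi-prime, i.e. $\{0\}$ is the only two-sided ideal $J$ of $\mathcal A$ with $J^2=\{0\}$. Let $T:\mathcal A\to\mathcal A$ be a multiplier, i.e. a mapping with $u(Tv)=(Tu)v$ for all $u,v\in\mathcal A$. Then $T$ is a bounded linear operator on $\mathcal A$, and $$\sigma_{desc}(T)=\sigma_{desc}(T,\mathcal B(\mathcal A)).$$ Here $\mathcal B(\mathcal A)$ is the algebra of all bounded linear operators on $\mathcal A$. The descent $d(S)$ of a linear operator $S$ is the least integer $q\ge 0$ such that $S^q$ and $S^{q+1}$ have the same range, with $d(S)=\infty$ if there is no such $q$. The descent spectrum of $T$ as an operator is $\sigma_{desc}(T)=\{\lambda\in\mathbb C : d(\lambda I-T)=\infty\}$. The descent spectrum of $T$ as an element of $\mathcal B(\mathcal A)$ is $\sigma_{desc}(T,\mathcal B(\mathcal A))=\{\lambda\in\mathbb C : d(L_{T-\lambda I})=\infty\}$, where $L_a$ denotes the left multiplication operator $x\mapsto ax$ on $\mathcal B(\mathcal A)$. -/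

import Mathlib

/-- The descent of a linear operator: the least `q` with `R(T ^ q) = R(T ^ (q + 1))`, and `∞` (that
is, `⊤`, the infimum of the empty set in `ℕ∞`) if there is no such `q`. -/
noncomputable def descent {X : Type*} [AddCommGroup X] [Module ℂ X] (T : X →ₗ[ℂ] X) : ℕ∞ :=
  sInf ((fun q : ℕ => (q : ℕ∞)) ''
    {q : ℕ | LinearMap.range (T ^ q) = LinearMap.range (T ^ (q + 1))})

/-- The descent spectrum of a bounded operator `T` on `X`, as an operator. -/
def operatorDescentSpectrum {X : Type*} [NormedAddCommGroup X] [NormedSpace ℂ X]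
    (T : X →L[ℂ] X) : Set ℂ :=
  {z : ℂ | descent (z • ContinuousLinearMap.id ℂ X - T : X →L[ℂ] X).toLinearMap = ⊤}

/-- The descent of an element `a` of a unital complex algebra: the descent of the
left multiplication operator `x ↦ a * x`. -/
noncomputable def elementDescent {B : Type*} [Ring B] [Algebra ℂ B] (a : B) : ℕ∞ :=
  descent (LinearMap.mulLeft ℂ a)

/-- The descent spectrum of an element of a unital complex algebra. -/
def elementDescentSpectrum {B : Type*} [Ring B] [Algebra ℂ B] (a : B) : Set ℂ :=
  {z : ℂ | elementDescent (a - algebraMap ℂ B z) = ⊤}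

/-- A map `T` on an algebra is a multiplier if `u (T v) = (T u) v` for all `u`, `v`.
No linearity or continuity is required. -/
def IsMultiplier {A : Type*} [Mul A] (T : A → A) : Prop :=
  ∀ u v : A, u * T v = T u * v

/-- A (not necessarily unital) complex algebra is semi-prime if `{0}` is the only two-sided
ideal `J` with `J ^ 2 = {0}`. -/
def IsSemiprimeAlgebra (A : Type*) [NonUnitalRing A] [Module ℂ A] : Prop :=
  ∀ J : Submodule ℂ A,
    (∀ a : A, ∀ x ∈ J, a * x ∈ J ∧ x * a ∈ J) →
    (∀ x ∈ J, ∀ y ∈ J, x * y = 0) → J = ⊥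

section Semiprime

variable {A : Type*} [NonUnitalNormedCommRing A] [NormedSpace ℂ A]

/-! Semi-primeness makes the annihilator of `A` trivial, so identities can be checked after
multiplying by every `a`, and excludes nonzero elements of square zero, so a multiplier `S`
satisfies `ker S ^ n = ker S` for `n ≥ 1`. If `S` has finite descent, this gives `S x = S ^ 3 w`
with `S w` determined by `x`. Then `x ↦ S w` is a multiplier `U`, hence bounded, and `S = S ^ 2 * U`
bounds the descent of left multiplication by one. The converse holds for any bounded operator. -/

theorem IsSemiprimeAlgebra.eq_zero_of_forall_mul_eq_zero [SMulCommClass ℂ A A]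
    (hA : IsSemiprimeAlgebra A) {x : A} (hx : ∀ a : A, a * x = 0) : x = 0 := by
  let J : Submodule ℂ A :=
    { carrier := {y | ∀ a : A, a * y = 0}
      add_mem' := fun hy hz a => by rw [mul_add, hy a, hz a, add_zero]
      zero_mem' := fun a => mul_zero a
      smul_mem' := fun c y hy a => by rw [mul_smul_comm, hy a, smul_zero] }
  have hJ : J = ⊥ := by
    refine hA J (fun a y hy => ?_) (fun y _ z hz => hz y)
    have h0 : a * y = 0 := hy a
    rw [mul_comm y a, h0]
    exact ⟨J.zero_mem, J.zero_mem⟩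
  exact (Submodule.mem_bot ℂ).1 (hJ ▸ (show x ∈ J from hx))

theorem IsSemiprimeAlgebra.eq_of_forall_mul_eq [SMulCommClass ℂ A A]
    (hA : IsSemiprimeAlgebra A) {x y : A} (h : ∀ a : A, a * x = a * y) : x = y :=
  sub_eq_zero.1 (hA.eq_zero_of_forall_mul_eq_zero fun a => by rw [mul_sub, h a, sub_self])

/-- The ideal `xA` has square zero, so it vanishes and `x` annihilates `A`. -/
theorem IsSemiprimeAlgebra.eq_zero_of_mul_self_eq_zero [IsScalarTower ℂ A A]
    [SMulCommClass ℂ A A] (hA : IsSemiprimeAlgebra A) {x : A} (hx : x * x = 0) : x = 0 := by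
  have hJ : LinearMap.range (LinearMap.mulLeft ℂ x) = ⊥ := by
    refine hA _ ?_ ?_
    · rintro a _ ⟨b, rfl⟩
      refine ⟨⟨a * b, ?_⟩, ⟨b * a, ?_⟩⟩
      · simp only [LinearMap.mulLeft_apply]
        exact mul_left_comm x a b
      · simp only [LinearMap.mulLeft_apply]
        exact (mul_assoc x b a).symm
    · rintro _ ⟨a, rfl⟩ _ ⟨b, rfl⟩
      simp only [LinearMap.mulLeft_apply]
      rw [mul_mul_mul_comm, hx, zero_mul]
  refine hA.eq_zero_of_forall_mul_eq_zero fun a => ?_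
  rw [mul_comm]
  exact LinearMap.congr_fun (LinearMap.range_eq_bot.1 hJ) a

/-- A multiplier of a commutative semi-prime Banach algebra is linear and continuous. -/
theorem IsMultiplier.exists_continuousLinearMap [IsScalarTower ℂ A A] [SMulCommClass ℂ A A]
    [CompleteSpace A] (hA : IsSemiprimeAlgebra A) {T : A → A} (hT : IsMultiplier T) :
    ∃ S : A →L[ℂ] A, ∀ x : A, S x = T x := by
  let L : A →ₗ[ℂ] A :=
    { toFun := T
      map_add' := fun x y => hA.eq_of_forall_mul_eq fun a => by
        rw [hT, mul_add, mul_add, hT, hT]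
      map_smul' := fun c x => hA.eq_of_forall_mul_eq fun a => by
        rw [hT, RingHom.id_apply, mul_smul_comm, mul_smul_comm, hT] }
  have hL : Continuous L := by
    -- Closed graph: `a * T (u n) = T a * u n` converges to both `a * y` and `a * T x`.
    refine L.continuous_of_seq_closed_graph fun u x y hu hy => ?_
    refine hA.eq_of_forall_mul_eq fun a => ?_
    have h₁ : Filter.Tendsto (fun n => a * L (u n)) Filter.atTop (nhds (a * y)) :=
      hy.const_mul a
    have h₂ : Filter.Tendsto (fun n => a * L (u n)) Filter.atTop (nhds (a * L x)) := by
      have h := hu.const_mul (T a)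
      rw [← hT a x] at h
      exact h.congr fun n => (hT a (u n)).symm
    exact tendsto_nhds_unique h₁ h₂
  exact ⟨⟨L, hL⟩, fun _ => rfl⟩

theorem IsMultiplier.smul_sub [IsScalarTower ℂ A A] [SMulCommClass ℂ A A] {T : A → A}
    (hT : IsMultiplier T) (z : ℂ) : IsMultiplier fun x => z • x - T x := fun u v => by
  simp only [mul_sub, sub_mul, mul_smul_comm, smul_mul_assoc, hT u v]

theorem IsMultiplier.map_mul [SMulCommClass ℂ A A] (hA : IsSemiprimeAlgebra A) {T : A → A}
    (hT : IsMultiplier T) (u v : A) : T (u * v) = u * T v :=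
  hA.eq_of_forall_mul_eq fun a => by rw [hT, mul_left_comm, ← hT a v, mul_left_comm]

/-- The ascent of a multiplier of a commutative semi-prime algebra is at most one. -/
theorem IsMultiplier.eq_zero_of_apply_apply [IsScalarTower ℂ A A] [SMulCommClass ℂ A A]
    (hA : IsSemiprimeAlgebra A) {S : A →ₗ[ℂ] A} (hS : IsMultiplier S) {x : A}
    (hx : S (S x) = 0) : S x = 0 :=
  hA.eq_zero_of_mul_self_eq_zero (by rw [← hS, hx, mul_zero])

theorem IsMultiplier.eq_zero_of_pow_succ_apply [IsScalarTower ℂ A A] [SMulCommClass ℂ A A]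
    (hA : IsSemiprimeAlgebra A) {S : A →ₗ[ℂ] A} (hS : IsMultiplier S) {q : ℕ} {x : A}
    (hx : (S ^ (q + 1)) x = 0) : S x = 0 := by
  induction q with
  | zero => simpa using hx
  | succ q ih =>
    refine ih ?_
    rw [pow_succ', pow_succ', Module.End.mul_apply, Module.End.mul_apply] at hx
    rw [pow_succ', Module.End.mul_apply]
    exact hS.eq_zero_of_apply_apply hA hx

theorem IsMultiplier.exists_pow_three_apply_eq [IsScalarTower ℂ A A] [SMulCommClass ℂ A A]
    (hA : IsSemiprimeAlgebra A) {S : A →ₗ[ℂ] A} (hS : IsMultiplier S) {q : ℕ}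
    (hq : LinearMap.range (S ^ q) = LinearMap.range (S ^ (q + 1))) (x : A) :
    ∃ w, S (S (S w)) = S x := by
  obtain ⟨y, hy⟩ : (S ^ q) x ∈ LinearMap.range (S ^ (q + 1)) := hq ▸ ⟨x, rfl⟩
  obtain ⟨w, hw⟩ : (S ^ q) y ∈ LinearMap.range (S ^ (q + 1)) := hq ▸ ⟨y, rfl⟩
  refine ⟨w, sub_eq_zero.1 ?_⟩
  rw [← map_sub]
  -- `S ^ q x = S ^ (q + 1) y` and `S ^ q y = S ^ (q + 1) w` give `S ^ (q + 1) (S ^ 2 w - x) = 0`.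
  refine hS.eq_zero_of_pow_succ_apply hA (q := q) ?_
  have h : (S ^ (q + 1)) (S (S w)) = S (S ((S ^ (q + 1)) w)) := by
    simp only [← Module.End.mul_apply, ← mul_assoc, ← pow_succ, ← pow_succ']
  rw [map_sub, h, hw, pow_succ', Module.End.mul_apply, ← hy, pow_succ', Module.End.mul_apply,
    sub_self]

/-- A multiplier of finite descent on a commutative semi-prime Banach algebra factors as
`S = S ^ 2 * U`, where `U` is again a multiplier, hence bounded. -/
theorem IsMultiplier.exists_eq_sq_mul [IsScalarTower ℂ A A] [SMulCommClass ℂ A A]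
    [CompleteSpace A] (hA : IsSemiprimeAlgebra A) {S : A →L[ℂ] A} (hS : IsMultiplier S) {q : ℕ}
    (hq : LinearMap.range (S.toLinearMap ^ q) = LinearMap.range (S.toLinearMap ^ (q + 1))) :
    ∃ U : A →L[ℂ] A, S = S ^ 2 * U := by
  have hS' : IsMultiplier S.toLinearMap := hS
  choose W hW using hS'.exists_pow_three_apply_eq hA hq
  simp only [ContinuousLinearMap.coe_coe] at hW
  -- `W` is an arbitrary choice, but only modulo `ker S ^ 3 = ker S`, so `S (W x)` is canonical.
  -- Applying `S ^ 3` to `u * W v - v * W u` gives `u * S v - v * S u = 0`.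
  have hU : IsMultiplier fun x => S (W x) := fun u v => by
    simp only
    rw [← sub_eq_zero, ← hS.map_mul hA, mul_comm (S (W u)), ← hS.map_mul hA, ← map_sub]
    refine hS'.eq_zero_of_pow_succ_apply hA (q := 2) ?_
    simp only [pow_succ, pow_zero, one_mul, Module.End.mul_apply, ContinuousLinearMap.coe_coe,
      map_sub, hS.map_mul hA, hW]
    rw [hS, mul_comm, sub_self]
  obtain ⟨U, hU⟩ := hU.exists_continuousLinearMap hA
  refine ⟨U, ContinuousLinearMap.ext fun x => ?_⟩
  rw [pow_two]
  change S x = S (S (U x))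
  rw [hU, hW]

end Semiprime

section Descent

theorem descent_eq_top_iff {X : Type*} [AddCommGroup X] [Module ℂ X] (T : X →ₗ[ℂ] X) :
    descent T = ⊤ ↔ ∀ q : ℕ, LinearMap.range (T ^ q) ≠ LinearMap.range (T ^ (q + 1)) := by
  simp [descent, sInf_eq_top]

theorem descent_neg {X : Type*} [AddCommGroup X] [Module ℂ X] (T : X →ₗ[ℂ] X) :
    descent (-T) = descent T := by
  have h (q : ℕ) : LinearMap.range ((-T) ^ q) = LinearMap.range (T ^ q) := by
    rcases q.even_or_odd with h | h
    · rw [h.neg_pow]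
    · rw [h.neg_pow, LinearMap.range_neg]
  simp only [descent, h]

theorem elementDescent_neg {B : Type*} [Ring B] [Algebra ℂ B] (a : B) :
    elementDescent (-a) = elementDescent a := by
  rw [elementDescent, elementDescent, ← descent_neg]
  congr 1
  ext x
  simp

variable {X : Type*} [NormedAddCommGroup X] [NormedSpace ℂ X]

theorem range_pow_eq_of_range_mulLeft_pow_eq {S : X →L[ℂ] X} {q : ℕ}
    (hq : LinearMap.range (LinearMap.mulLeft ℂ S ^ q) =
      LinearMap.range (LinearMap.mulLeft ℂ S ^ (q + 1))) :
    LinearMap.range (S.toLinearMap ^ q) = LinearMap.range (S.toLinearMap ^ (q + 1)) := by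
  simp only [LinearMap.pow_mulLeft] at hq
  -- Evaluating at the identity turns range equality into a factorization `S ^ q = S ^ (q + 1) * U`.
  obtain ⟨U, hU⟩ : S ^ q ∈ LinearMap.range (LinearMap.mulLeft ℂ (S ^ (q + 1))) :=
    hq ▸ ⟨1, by simp⟩
  refine le_antisymm ?_ ?_
  · rintro _ ⟨x, rfl⟩
    refine ⟨U x, ?_⟩
    rw [← ContinuousLinearMap.toLinearMap_pow, ← ContinuousLinearMap.toLinearMap_pow, ← hU]
    rfl
  · rw [pow_succ]
    exact LinearMap.range_comp_le_range _ _

theorem range_mulLeft_pow_one_eq_of_eq_sq_mul {S U : X →L[ℂ] X} (h : S = S ^ 2 * U) :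
    LinearMap.range (LinearMap.mulLeft ℂ S ^ 1) =
      LinearMap.range (LinearMap.mulLeft ℂ S ^ (1 + 1)) := by
  simp only [LinearMap.pow_mulLeft]
  refine le_antisymm ?_ ?_
  · rintro _ ⟨V, rfl⟩
    refine ⟨U * V, ?_⟩
    rw [LinearMap.mulLeft_apply, LinearMap.mulLeft_apply, ← mul_assoc, one_add_one_eq_two, ← h,
      pow_one]
  · rintro _ ⟨V, rfl⟩
    refine ⟨S * V, ?_⟩
    rw [LinearMap.mulLeft_apply, LinearMap.mulLeft_apply, ← mul_assoc, ← pow_succ]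

end Descent

theorem IsMultiplier.descent_eq_top_iff {A : Type*} [NonUnitalNormedCommRing A] [NormedSpace ℂ A]
    [IsScalarTower ℂ A A] [SMulCommClass ℂ A A] [CompleteSpace A]
    (hA : IsSemiprimeAlgebra A) {S : A →L[ℂ] A} (hS : IsMultiplier S) :
    descent S.toLinearMap = ⊤ ↔ elementDescent S = ⊤ := by
  rw [elementDescent, _root_.descent_eq_top_iff, _root_.descent_eq_top_iff]
  refine ⟨fun h q hq => h q (range_pow_eq_of_range_mulLeft_pow_eq hq), fun h q hq => ?_⟩
  obtain ⟨U, hU⟩ := hS.exists_eq_sq_mul hA hq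
  exact h 1 (range_mulLeft_pow_one_eq_of_eq_sq_mul hU)

theorem corollary2 {A : Type*} [NonUnitalNormedCommRing A] [NormedSpace ℂ A]
    [IsScalarTower ℂ A A] [SMulCommClass ℂ A A] [CompleteSpace A]
    (hA : IsSemiprimeAlgebra A) (T : A → A) (hT : IsMultiplier T) :
    ∃ S : A →L[ℂ] A, (∀ x : A, S x = T x) ∧
      operatorDescentSpectrum S = elementDescentSpectrum (B := A →L[ℂ] A) S := by
  obtain ⟨S, hS⟩ := hT.exists_continuousLinearMap hA
  refine ⟨S, hS, Set.ext fun z => ?_⟩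
  have hz : IsMultiplier (z • ContinuousLinearMap.id ℂ A - S) := by
    have h := hT.smul_sub z
    simp only [← hS] at h
    exact h
  -- The two spectra use opposite signs, which does not affect descent.
  have hneg : S - algebraMap ℂ (A →L[ℂ] A) z = -(z • ContinuousLinearMap.id ℂ A - S) := by
    rw [neg_sub, Algebra.algebraMap_eq_smul_one]
    rfl
  simp only [operatorDescentSpectrum, elementDescentSpectrum, Set.mem_ofPred_eq]
  rw [hneg, elementDescent_neg]
  exact hz.descent_eq_top_iff hA
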